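/- Let $X$ and $S$ be nonempty finite sets and let $L=(L_{xy})_{x,y\in X}$ be a stochastic matrix ($L_{xy}\ge 0$ and $\sum_y L_{xy}=1$ for all $x$) which is irreducible, i.e. for all $x,y\in X$ there are letters $x_1=x,x_2,\dots,x_n=y$ with $L_{x_ix_{i+1}}>0$ for $1\le i<n$. Let $\boldsymbol l$ be the stationary probability vector of $L$ ($\boldsymbol l_x\ge 0$, $\sum_x \boldsymbol l_x=1$, $\boldsymbol lL=\boldsymbol l$), and let $\mu$ be the corresponding Markov measure on $X^{\mathbb N}$, that is, the Borel probability measure with $$\mu(x_1x_2\ldots x_nX^{\mathbb N})=\boldsymbol l_{x_1}L_{x_1x_2}\cdots L_{x_{n-1}x_n}$$ for all $n\ge 1$ and $x_1,\dots,x_n\in X$, where $uX^{\mathbb N}$ denotes the set of all infinite sequences with prefix $u$. Let $\mathcal A=(X,S,\pi,\lambda)$ be a Mealy automaton with alphabet $X$, set of states $S$, transition function $\pi:S\times X\to S$ and output function $\lambda:S\times X\to X$. Extend $\pi$ to finite words by $\pi(s,\varnothing)=s$ and $\pi(s,xw)=\pi(\pi(s,x),w)$. A state $g\in S$ acts on $X^{\mathbb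 N}$ by $g(\omega_1\omega_2\ldots)=y_1y_2\ldots$, where $s_1=g$, $y_i=\lambda(s_i,\omega_i)$ and $s_{i+1}=\pi(s_i,\omega_i)$ for $i\ge 1$. For $s,s'\in S$ and $x,y\in X$, write $s\xrightarrow{x|y}s'$ if $\pi(s,x)=s'$ and $\lambda(s,x)=y$; these are the edges of the Moore diagram of $\mathcal A$. Suppose that $\mathcal A$ is $L$-strongly connected: for all $s,r\in S$ and $x,y\in X$ there is a (possibly empty) finite word $w$ over $X$ such that $\pi(s,xw)=r$ and $L_{ab}\neq 0$ for every two consecutive letters $a,b$ of the word $xwy$. Let $T$ be the stochastic matrix indexed by $S\times X$ with entries $$T_{(s_0,x_0)(s_1,x_1)}=\begin{cases}L_{x_0x_1}&\text{if }\pi(s_0,x_0)=s_1,\\ 0&\text{otherwise.}\end{cases}$$ Then $T$ has a unique stationary probability vector $\boldsymbol t$, and for every state $g\in S$, every letter $x\in X$ and $\mu$-almost all $\omega\in X^{\mathbb N}$, $$\lim_{n\to\infty}\frac1n\sum_{i=0}^{n-1}\chi_{xX^{\mathbb N}}\bigl(\sigma^i(g(\omega))\bigr)=\sum_{s_0\xrightarrow{x_0|x}s_1}\boldsymbol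 t(s_0,x_0),$$ where $\sigma$ is the shift on $X^{\mathbb N}$, $\chi_{xX^{\mathbb N}}$ is the characteristic function of $xX^{\mathbb N}$, and the sum is over all edges of the Moore diagram of $\mathcal A$ with output letter $x$; in particular, the limit (the frequency of $x$ in $g(\omega)$) exists. -/

import Mathlib

open MeasureTheory Filter Topology Matrix

/-- The shift on infinite sequences, deleting the first symbol. -/
def seqShift {X : Type*} (ω : ℕ → X) : ℕ → X := fun n => ω (n + 1)

/-- The cylinder of all infinite sequences that have the word `u` of length `n` as a prefix. -/
def seqCylinder {X : Type*} {n : ℕ} (u : Fin n → X) : Set (ℕ → X) :=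
  {ω | ∀ i : Fin n, ω i = u i}

/-- `l` is a stationary probability vector of the matrix `L`, that is, a probability vector
(a nonnegative vector with sum one) such that `l L = l`. -/
def IsStationaryProbVec {X : Type*} [Fintype X] (L : Matrix X X ℝ) (l : X → ℝ) : Prop :=
  l ∈ stdSimplex ℝ X ∧ l ᵥ* L = l

/-- The probability measure `μ` is the Markov measure with initial distribution `l` and
transition matrix `L`: the cylinder of a nonempty word `u₀ u₁ … uₙ` has measure
`l u₀ * L u₀ u₁ * ⋯ * L uₙ₋₁ uₙ`. -/
structure IsMarkovMeasure {X : Type*} [MeasurableSpace X]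
    (μ : Measure (ℕ → X)) (L : Matrix X X ℝ) (l : X → ℝ) : Prop where
  isProbabilityMeasure : IsProbabilityMeasure μ
  measure_cylinder : ∀ (n : ℕ) (u : Fin (n + 1) → X),
    μ (seqCylinder u) = ENNReal.ofReal (l (u 0) * ∏ i : Fin n, L (u i.castSucc) (u i.succ))

/-- A Mealy automaton with alphabet `X` and set of states `S`. -/
structure MealyAutomaton (X S : Type*) where
  /-- The transition function. -/
  next : S → X → S
  /-- The output function. -/
  out : S → X → X

namespace MealyAutomaton

variable {X S : Type*} (A : MealyAutomaton X S)

/-- The state reached from `s` after reading a finite word. -/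
def run (s : S) (w : List X) : S := w.foldl A.next s

/-- The state in which the automaton started at `s` reads the letter `ω n` of the input `ω`. -/
def stateAt (s : S) (ω : ℕ → X) : ℕ → S
  | 0 => s
  | n + 1 => A.next (stateAt s ω n) (ω n)

/-- The action of the state `s` on infinite sequences: the output sequence produced from
the input `ω` by the automaton with initial state `s`. -/
def action (s : S) (ω : ℕ → X) : ℕ → X := fun n => A.out (A.stateAt s ω n) (ω n)

/-- The automaton is `L`-strongly connected: for all states `s`, `r` and letters `x`, `y` there is
a (possibly empty) word `w` such that reading `xw` leads from `s` to `r`, and all transitions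
between consecutive letters of the word `xwy` have nonzero entries in `L`. -/
def IsStronglyConnectedFor (L : Matrix X X ℝ) : Prop :=
  ∀ (s r : S) (x y : X), ∃ w : List X,
    A.run s (x :: w) = r ∧ List.IsChain (fun a b => L a b ≠ 0) (x :: (w ++ [y]))

/-- The stochastic matrix `T` on `S × X`, whose entry at `(s₀, x₀), (s₁, x₁)` is `L x₀ x₁` if the
transition function sends `(s₀, x₀)` to `s₁`, and `0` otherwise. -/
def skewMatrix [DecidableEq S] (L : Matrix X X ℝ) : Matrix (S × X) (S × X) ℝ :=
  Matrix.of fun p q => if A.next p.1 p.2 = q.1 then L p.2 q.2 else 0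

/-- The edges `s₀ →(x₀|x) s₁` of the Moore diagram with output letter `x`, as triples
`(s₀, x₀, s₁)`. -/
def edgesWithOutput [Fintype X] [Fintype S] [DecidableEq X] [DecidableEq S] (x : X) :
    Finset (S × X × S) :=
  Finset.univ.filter fun e => A.next e.1 e.2.1 = e.2.2 ∧ A.out e.1 e.2.1 = x

end MealyAutomaton

/-! While the automaton reads ω, the pairs (state, input letter) form a Markov chain with matrix
`T`, and the i-th output letter is a function of the i-th pair. So the claim is an ergodic theorem
for this chain. It starts in the fixed state `g`, in general not in its stationary law, so a
martingale argument replaces stationarity.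

`L`-strong connectedness makes the chain strongly connected. Its harmonic functions are then
constant, and `exists_poisson_solution` writes any `f` as `h - T h` plus its `t`-mean. Along a path,
the sum of `f` minus its mean is a bounded boundary term plus a sum of bounded martingale
differences. Orthogonality of the latter comes from the Markov property
(`IsMarkovMeasure.integral_next`), and `ae_tendsto_avg_zero` shows that their averages vanish almost
surely. The Poisson equation also gives uniqueness of `t`. -/

/-! ### Stationary vectors and the Poisson equation -/

section Stochastic

variable {E : Type*} [Fintype E] [DecidableEq E] {T : Matrix E E ℝ}

/-- A finite stochastic matrix has a stationary probability vector. -/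
theorem exists_isStationaryProbVec [Nonempty E] (hT : T ∈ rowStochastic ℝ E) :
    ∃ t, IsStationaryProbVec T t := by
  -- Since `T` fixes the constant vector 1, `1 - T` is singular and so has a left kernel vector. Its
  -- normalized absolute value will be stationary.
  obtain ⟨v, hv0, hv⟩ : ∃ v ≠ 0, v ᵥ* (1 - T) = 0 := by
    rw [exists_vecMul_eq_zero_iff, ← exists_mulVec_eq_zero_iff]
    exact ⟨1, one_ne_zero, by rw [sub_mulVec, one_mulVec, hT.2, sub_self]⟩
  have hvT (j : E) : ∑ i, v i * T i j = v j := by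
    have := congrFun hv j
    rw [vecMul_sub, vecMul_one, Pi.sub_apply, Pi.zero_apply, sub_eq_zero] at this
    exact this.symm
  have hle (j : E) : |v j| ≤ ∑ i, |v i| * T i j := by
    calc |v j| = |∑ i, v i * T i j| := by rw [hvT]
      _ ≤ ∑ i, |v i * T i j| := Finset.abs_sum_le_sum_abs _ _
      _ = ∑ i, |v i| * T i j := by simp_rw [abs_mul, abs_of_nonneg (hT.1 _ _)]
  have hsum : ∑ j, |v j| = ∑ j, ∑ i, |v i| * T i j := by
    rw [Finset.sum_comm]
    simp_rw [← Finset.mul_sum, sum_row_of_mem_rowStochastic hT, mul_one]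
  -- Both sides of `hle` have the same total, so every inequality is an equality.
  have heq := (Finset.sum_eq_sum_iff_of_le fun j _ => hle j).1 hsum
  have hpos : 0 < ∑ j, |v j| := by
    obtain ⟨j, hj⟩ := Function.ne_iff.1 hv0
    exact Finset.sum_pos' (fun _ _ => abs_nonneg _) ⟨j, Finset.mem_univ j, abs_pos.2 hj⟩
  refine ⟨fun j => |v j| / ∑ i, |v i|, ⟨fun j => by positivity, ?_⟩, ?_⟩
  · rw [← Finset.sum_div, div_self hpos.ne']
  · ext j
    change ∑ i, |v i| / _ * T i j = _
    rw [heq j (Finset.mem_univ j), Finset.sum_div]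
    exact Finset.sum_congr rfl fun i _ => by ring

/-- The maximum principle: on a strongly connected finite chain, harmonic functions are constant. -/
theorem eq_of_mulVec_eq_self (hT : T ∈ rowStochastic ℝ E)
    (hconn : ∀ p q, Relation.ReflTransGen (fun a b => T a b ≠ 0) p q)
    {h : E → ℝ} (hh : T *ᵥ h = h) (p q : E) : h p = h q := by
  have : Nonempty E := ⟨p⟩
  obtain ⟨m, hm⟩ := Finite.exists_max h
  have key (r : E) : h r = h m := by
    induction hconn m r with
    | refl => rfl
    | @tail a b _ hab ih =>
      -- `h a` is an average of values at most `h m`; if it equals `h m`, so does every value with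
      -- nonzero weight.
      have hsum : ∑ c, T a c * h c = ∑ c, T a c * h m := by
        rw [← Finset.sum_mul, sum_row_of_mem_rowStochastic hT, one_mul, ← ih]
        exact congrFun hh a
      have := (Finset.sum_eq_sum_iff_of_le fun c _ =>
        mul_le_mul_of_nonneg_left (hm c) (hT.1 a c)).1 hsum b (Finset.mem_univ b)
      exact mul_left_cancel₀ hab this
  rw [key p, key q]

/-- The Poisson equation on a strongly connected finite chain. -/
theorem exists_poisson_solution (hT : T ∈ rowStochastic ℝ E)
    (hconn : ∀ p q, Relation.ReflTransGen (fun a b => T a b ≠ 0) p q)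
    {t : E → ℝ} (ht : IsStationaryProbVec T t) (f : E → ℝ) :
    ∃ h : E → ℝ, ∀ p, f p = h p - (T *ᵥ h) p + t ⬝ᵥ f := by
  have ht1 : t ⬝ᵥ 1 = 1 := by simpa [dotProduct] using ht.1.2
  have htT (h : E → ℝ) : t ⬝ᵥ (T *ᵥ h) = t ⬝ᵥ h := by rw [dotProduct_mulVec, ht.2]
  -- The rank-one term removes the constants from the kernel of `1 - T`. Pairing with `t` then
  -- identifies the added constant as the `t`-mean of `f`.
  let Φ : (E → ℝ) →ₗ[ℝ] (E → ℝ) :=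
    { toFun := fun h => h - T *ᵥ h + (t ⬝ᵥ h) • 1
      map_add' := fun a b => by
        rw [mulVec_add, dotProduct_add, add_smul]; abel
      map_smul' := fun c a => by
        simp only [mulVec_smul, dotProduct_smul, RingHom.id_apply, smul_add, smul_sub, smul_smul,
          smul_eq_mul] }
  have htΦ (h : E → ℝ) : t ⬝ᵥ Φ h = t ⬝ᵥ h := by
    change t ⬝ᵥ (h - T *ᵥ h + (t ⬝ᵥ h) • 1) = _
    rw [dotProduct_add, dotProduct_sub, htT, dotProduct_smul, ht1]
    simp
  have hinj : Function.Injective Φ := by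
    rw [injective_iff_map_eq_zero]
    intro h hΦ
    have h0 : t ⬝ᵥ h = 0 := by rw [← htΦ, hΦ, dotProduct_zero]
    have hharm : T *ᵥ h = h := by
      have : h - T *ᵥ h + (t ⬝ᵥ h) • 1 = 0 := hΦ
      rw [h0, zero_smul, add_zero, sub_eq_zero] at this
      exact this.symm
    ext p
    have hconst : h = h p • 1 := by
      ext q
      simpa using eq_of_mulVec_eq_self hT hconn hharm q p
    rw [hconst, dotProduct_smul, ht1] at h0
    simpa using h0
  obtain ⟨h, rfl⟩ := LinearMap.injective_iff_surjective.1 hinj f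
  refine ⟨h, fun p => ?_⟩
  rw [htΦ]
  change (h - T *ᵥ h + (t ⬝ᵥ h) • 1) p = _
  simp

/-- A strongly connected finite chain has a unique stationary probability vector. -/
theorem existsUnique_isStationaryProbVec [Nonempty E] (hT : T ∈ rowStochastic ℝ E)
    (hconn : ∀ p q, Relation.ReflTransGen (fun a b => T a b ≠ 0) p q) :
    ∃! t, IsStationaryProbVec T t := by
  obtain ⟨t, ht⟩ := exists_isStationaryProbVec hT
  refine ⟨t, ht, fun t' ht' => ?_⟩
  have ht1' : t' ⬝ᵥ 1 = 1 := by simpa [dotProduct] using ht'.1.2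
  -- Any stationary vector annihilates `h - T h`, so it gives every `f` the same mean as `t`.
  refine dotProduct_eq _ _ fun f => ?_
  obtain ⟨h, hh⟩ := exists_poisson_solution hT hconn ht f
  have hf : f = h - T *ᵥ h + (t ⬝ᵥ f) • 1 := by
    ext p
    simpa using hh p
  calc t' ⬝ᵥ f = t' ⬝ᵥ (h - T *ᵥ h + (t ⬝ᵥ f) • 1) := by rw [← hf]
    _ = t ⬝ᵥ f := by
      rw [dotProduct_add, dotProduct_sub, dotProduct_mulVec, ht'.2, dotProduct_smul, ht1']
      simp

end Stochastic

/-! ### Strong law for bounded orthogonal increments -/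

section LargeNumbers

variable {Ω : Type*} [MeasurableSpace Ω] {μ : Measure Ω} {D : ℕ → Ω → ℝ} {C : ℝ}

/-- The second moment of a sum of uniformly bounded martingale differences grows linearly. -/
theorem integral_sq_sum_le [IsProbabilityMeasure μ]
    (hD : ∀ n, Measurable (D n)) (hC : ∀ n ω, |D n ω| ≤ C)
    (horth : ∀ n, ∫ ω, (∑ i ∈ Finset.range n, D i ω) * D n ω ∂μ = 0) (n : ℕ) :
    ∫ ω, (∑ i ∈ Finset.range n, D i ω) ^ 2 ∂μ ≤ n * C ^ 2 := by
  have hint (n : ℕ) : MemLp (fun ω => ∑ i ∈ Finset.range n, D i ω) ⊤ μ := by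
    refine memLp_finsetSum _ fun i _ => ?_
    exact memLp_top_of_bound (hD i).aestronglyMeasurable C (ae_of_all _ fun ω => hC i ω)
  have hint1 (n : ℕ) : MemLp (D n) ⊤ μ :=
    memLp_top_of_bound (hD n).aestronglyMeasurable C (ae_of_all _ fun ω => hC n ω)
  induction n with
  | zero => simp
  | succ n ih =>
    have h1 : Integrable (fun ω => (∑ i ∈ Finset.range n, D i ω) ^ 2) μ :=
      ((hint n).mono_exponent le_top).integrable_sq
    have h2 : Integrable (fun ω => (∑ i ∈ Finset.range n, D i ω) * D n ω) μ :=
      ((hint n).mono_exponent (p := 2) le_top).integrable_mul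
        ((hint1 n).mono_exponent (p := 2) le_top)
    have h3 : Integrable (fun ω => D n ω ^ 2) μ :=
      ((hint1 n).mono_exponent le_top).integrable_sq
    have h4 : ∫ ω, D n ω ^ 2 ∂μ ≤ C ^ 2 := by
      calc ∫ ω, D n ω ^ 2 ∂μ ≤ ∫ _, C ^ 2 ∂μ :=
            integral_mono h3 (integrable_const _) fun ω =>
              sq_le_sq' (abs_le.1 (hC n ω)).1 (abs_le.1 (hC n ω)).2
        _ = C ^ 2 := by simp
    calc ∫ ω, (∑ i ∈ Finset.range (n + 1), D i ω) ^ 2 ∂μ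
        = ∫ ω, ((∑ i ∈ Finset.range n, D i ω) ^ 2
            + 2 * ((∑ i ∈ Finset.range n, D i ω) * D n ω) + D n ω ^ 2) ∂μ := by
          congr with ω
          rw [Finset.sum_range_succ]
          ring
      _ = ∫ ω, (∑ i ∈ Finset.range n, D i ω) ^ 2 ∂μ + ∫ ω, D n ω ^ 2 ∂μ := by
          have h12 : Integrable (fun ω => (∑ i ∈ Finset.range n, D i ω) ^ 2
              + 2 * ((∑ i ∈ Finset.range n, D i ω) * D n ω)) μ := h1.add (h2.const_mul 2)
          rw [integral_add h12 h3, integral_add h1 (h2.const_mul 2),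
            integral_const_mul, horth]
          simp
      _ ≤ (n + 1 : ℕ) * C ^ 2 := by push_cast; linarith

/-- Random variables with summable second moments tend to zero almost surely. -/
theorem ae_tendsto_zero_of_summable_integral_sq {Y : ℕ → Ω → ℝ} (hY : ∀ n, MemLp (Y n) 2 μ)
    {b : ℕ → ℝ} (hb : Summable b) (hle : ∀ n, ∫ ω, Y n ω ^ 2 ∂μ ≤ b n) :
    ∀ᵐ ω ∂μ, Tendsto (fun n => Y n ω) atTop (𝓝 0) := by
  have hmeas (n : ℕ) : AEMeasurable (fun ω => ENNReal.ofReal (Y n ω ^ 2)) μ :=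
    ((hY n).1.aemeasurable.pow_const 2).ennreal_ofReal
  -- By Tonelli the sum of the squares is integrable, hence almost surely finite.
  have hfin : ∫⁻ ω, ∑' n, ENNReal.ofReal (Y n ω ^ 2) ∂μ ≠ ⊤ := by
    rw [lintegral_tsum hmeas]
    refine ne_top_of_le_ne_top hb.tsum_ofReal_ne_top (ENNReal.tsum_le_tsum fun n => ?_)
    rw [← ofReal_integral_eq_lintegral_ofReal (hY n).integrable_sq
      (ae_of_all _ fun ω => sq_nonneg _)]
    exact ENNReal.ofReal_le_ofReal (hle n)
  filter_upwards [ae_lt_top' (AEMeasurable.tsum hmeas) hfin] with ω hω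
  have h0 := ENNReal.tendsto_atTop_zero_of_tsum_ne_top hω.ne
  have h1 := (ENNReal.tendsto_toReal ENNReal.zero_ne_top).comp h0
  have h2 : Tendsto (fun n => Y n ω ^ 2) atTop (𝓝 0) := by
    refine h1.congr fun n => ?_
    exact ENNReal.toReal_ofReal (sq_nonneg _)
  have h3 := (Real.continuous_sqrt.tendsto 0).comp h2
  rw [tendsto_zero_iff_abs_tendsto_zero]
  simpa [Function.comp_def, Real.sqrt_sq_eq_abs] using h3

/-- If the averages of a bounded sequence tend to zero along the squares, then they tend to zero. -/
theorem tendsto_avg_of_tendsto_avg_sq {d : ℕ → ℝ} (hd : ∀ n, |d n| ≤ C)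
    (h : Tendsto (fun k : ℕ => (∑ i ∈ Finset.range (k ^ 2), d i) / (k ^ 2 : ℕ)) atTop (𝓝 0)) :
    Tendsto (fun n : ℕ => (∑ i ∈ Finset.range n, d i) / n) atTop (𝓝 0) := by
  -- Adding `C` makes the terms nonnegative and the partial sums monotone. Convergence along the
  -- squares then suffices, since consecutive squares have ratio tending to 1.
  have hsplit (n : ℕ) : ∑ i ∈ Finset.range n, (d i + C) = (∑ i ∈ Finset.range n, d i) + n * C := by
    simp [Finset.sum_add_distrib]
  have key : Tendsto (fun n : ℕ => (∑ i ∈ Finset.range n, (d i + C)) / n) atTop (𝓝 C) := by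
    refine tendsto_div_of_monotone_of_exists_subseq_tendsto_div
      (fun n => ∑ i ∈ Finset.range n, (d i + C)) C ?_ fun a ha => ⟨fun k => k ^ 2, ?_, ?_, ?_⟩
    · refine monotone_nat_of_le_succ fun n => ?_
      rw [Finset.sum_range_succ]
      linarith [(abs_le.1 (hd n)).1]
    · have hlim : Tendsto (fun n : ℕ => (1 + 1 / (n : ℝ)) ^ 2) atTop (𝓝 1) := by
        simpa using (tendsto_one_div_atTop_nhds_zero_nat (𝕜 := ℝ)).const_add 1 |>.pow 2
      filter_upwards [hlim.eventually_le_const ha, eventually_gt_atTop 0] with n hn hn0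
      have hn0' : (0 : ℝ) < n := by exact_mod_cast hn0
      calc (((n + 1) ^ 2 : ℕ) : ℝ) = (1 + 1 / (n : ℝ)) ^ 2 * ((n ^ 2 : ℕ) : ℝ) := by
            push_cast
            field_simp
        _ ≤ a * ((n ^ 2 : ℕ) : ℝ) := by gcongr
    · exact tendsto_pow_atTop two_ne_zero
    · have h' := h.add_const C
      rw [zero_add] at h'
      refine h'.congr' ?_
      filter_upwards [eventually_gt_atTop 0] with k hk
      have hk' : (0 : ℝ) < (k ^ 2 : ℕ) := by positivity
      rw [hsplit, add_div, mul_div_cancel_left₀ _ hk'.ne']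
  have key' := key.sub_const C
  rw [sub_self] at key'
  refine key'.congr' ?_
  filter_upwards [eventually_gt_atTop 0] with n hn
  have hn' : (0 : ℝ) < n := by exact_mod_cast hn
  rw [hsplit, add_div, mul_div_cancel_left₀ _ hn'.ne', add_sub_cancel_right]

/-- The strong law of large numbers for uniformly bounded martingale differences. -/
theorem ae_tendsto_avg_zero [IsProbabilityMeasure μ]
    (hD : ∀ n, Measurable (D n)) (hC : ∀ n ω, |D n ω| ≤ C)
    (horth : ∀ n, ∫ ω, (∑ i ∈ Finset.range n, D i ω) * D n ω ∂μ = 0) :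
    ∀ᵐ ω ∂μ, Tendsto (fun n : ℕ => (∑ i ∈ Finset.range n, D i ω) / n) atTop (𝓝 0) := by
  have hlp (n : ℕ) : MemLp (fun ω => (∑ i ∈ Finset.range n, D i ω) / n) 2 μ := by
    have hsum : MemLp (fun ω => ∑ i ∈ Finset.range n, D i ω) 2 μ :=
      memLp_finsetSum _ fun i _ => (memLp_top_of_bound (hD i).aestronglyMeasurable C
        (ae_of_all _ fun ω => hC i ω)).mono_exponent le_top
    simp_rw [div_eq_inv_mul]
    exact hsum.const_mul _
  -- At time `k ^ 2` the average has second moment at most `k ^ 2 * C ^ 2 / k ^ 4`.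
  have hb : Summable fun k : ℕ => C ^ 2 * (1 / (k : ℝ) ^ 2) :=
    (Real.summable_one_div_nat_pow.2 one_lt_two).mul_left _
  have hae := ae_tendsto_zero_of_summable_integral_sq (fun k : ℕ => hlp (k ^ 2)) hb fun k => by
    simp_rw [div_pow]
    rw [integral_div]
    rcases Nat.eq_zero_or_pos k with rfl | hk
    · simp
    have hk' : (0 : ℝ) < k := by exact_mod_cast hk
    calc (∫ ω, (∑ i ∈ Finset.range (k ^ 2), D i ω) ^ 2 ∂μ) / ((k ^ 2 : ℕ) : ℝ) ^ 2
        ≤ ((k ^ 2 : ℕ) * C ^ 2) / ((k ^ 2 : ℕ) : ℝ) ^ 2 := by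
          gcongr
          exact integral_sq_sum_le hD hC horth _
      _ = C ^ 2 * (1 / (k : ℝ) ^ 2) := by
          push_cast
          field_simp
  filter_upwards [hae] with ω hω
  exact tendsto_avg_of_tendsto_avg_sq (fun n => hC n ω) hω

end LargeNumbers

/-! ### Finite prefixes and the Markov property -/

section MarkovMeasure

variable {X : Type*} [Fintype X] [MeasurableSpace X] [DiscreteMeasurableSpace X]

/-- A function of finitely many coordinates of a sequence over a finite alphabet is measurable. -/
theorem measurable_of_eq_of_eq_prefix {β : Type*} [MeasurableSpace β] {f : (ℕ → X) → β} (n : ℕ)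
    (hf : ∀ ω ω' : ℕ → X, (∀ i < n, ω i = ω' i) → f ω = f ω') : Measurable f := by
  rcases isEmpty_or_nonempty X with hX | ⟨⟨x⟩⟩
  · exact measurable_of_empty f
  have : f = (fun u : Fin n → X => f fun i => if h : i < n then u ⟨i, h⟩ else x) ∘
      fun ω i => ω i := by
    ext1 ω
    exact hf _ _ fun i hi => by simp [hi]
  rw [this]
  exact (Measurable.of_discrete).comp (by fun_prop)

/-- The expectation of a function of the first `n` coordinates is a finite sum over words. -/
theorem integral_comp_prefix (μ : Measure (ℕ → X)) [IsFiniteMeasure μ] (n : ℕ)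
    (G : (Fin n → X) → ℝ) :
    ∫ ω, G (fun i => ω i) ∂μ = ∑ u, μ.real (seqCylinder u) * G u := by
  have hm : Measurable fun (ω : ℕ → X) (i : Fin n) => ω i := by fun_prop
  rw [← integral_map (φ := fun (ω : ℕ → X) (i : Fin n) => ω i) (f := G) hm.aemeasurable
    Measurable.of_discrete.aestronglyMeasurable, integral_fintype Integrable.of_finite]
  refine Finset.sum_congr rfl fun u _ => ?_
  rw [map_measureReal_apply hm (measurableSet_singleton u), smul_eq_mul]
  congr 2
  ext ω
  simp [seqCylinder, funext_iff]

variable {L : Matrix X X ℝ} {l : X → ℝ} {μ : Measure (ℕ → X)}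

/-- The Markov property: conditionally on the first letters `ω 0, …, ω n`, the next letter is
distributed according to the row `ω n` of the transition matrix. -/
theorem IsMarkovMeasure.integral_next (hμ : IsMarkovMeasure μ L l) (hl : ∀ x, 0 ≤ l x)
    (hL : ∀ x y, 0 ≤ L x y) (n : ℕ) (F : (ℕ → X) → X → ℝ)
    (hF : ∀ ω ω' : ℕ → X, (∀ i ≤ n, ω i = ω' i) → F ω = F ω') :
    ∫ ω, F ω (ω (n + 1)) ∂μ = ∫ ω, ∑ y, L (ω n) y * F ω y ∂μ := by
  have := hμ.isProbabilityMeasure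
  have hcyl (m : ℕ) (u : Fin (m + 1) → X) : μ.real (seqCylinder u) =
      l (u 0) * ∏ i : Fin m, L (u i.castSucc) (u i.succ) := by
    rw [measureReal_def, hμ.measure_cylinder, ENNReal.toReal_ofReal]
    exact mul_nonneg (hl _) (Finset.prod_nonneg fun _ _ => hL _ _)
  -- The filler `u 0` beyond position `n` is irrelevant by `hF`.
  let G (u : Fin (n + 1) → X) : X → ℝ :=
    F fun i => if h : i < n + 1 then u ⟨i, h⟩ else u 0
  have hG (ω : ℕ → X) : F ω = G fun i => ω i :=
    hF _ _ fun i hi => by simp [Nat.lt_succ_of_le hi]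
  have h1 := integral_comp_prefix μ (n + 2) fun v => G (Fin.init v) (v (Fin.last _))
  have h2 := integral_comp_prefix μ (n + 1) fun u => ∑ y, L (u (Fin.last _)) y * G u y
  simp_rw [hG]
  refine h1.trans (Eq.trans ?_ h2.symm)
  rw [← (Fin.snocEquiv fun _ : Fin (n + 2) => X).sum_comp, Fintype.sum_prod_type,
    Finset.sum_comm]
  refine Finset.sum_congr rfl fun u _ => ?_
  rw [Finset.mul_sum]
  refine Finset.sum_congr rfl fun y _ => ?_
  change μ.real (seqCylinder (Fin.snoc (α := fun _ => X) u y)) *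
    G (Fin.init (Fin.snoc (α := fun _ => X) u y)) (Fin.snoc (α := fun _ => X) u y (Fin.last _)) = _
  rw [hcyl, hcyl, Fin.init_snoc, Fin.snoc_last, Fin.prod_univ_castSucc]
  have h0 : (Fin.snoc (α := fun _ => X) u y : Fin (n + 2) → X) 0 = u 0 :=
    Fin.snoc_castSucc (α := fun _ => X) y u 0
  have hs (i : Fin n) : (Fin.snoc (α := fun _ => X) u y : Fin (n + 2) → X) i.castSucc.succ
      = u i.succ := Fin.snoc_castSucc (α := fun _ => X) y u i.succ
  have hl : (Fin.snoc (α := fun _ => X) u y : Fin (n + 2) → X) (Fin.last n).succ = y :=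
    Fin.snoc_last (α := fun _ => X) y u
  simp only [Fin.snoc_castSucc, h0, hs, hl]
  ring

end MarkovMeasure

/-! ### The chain of states and input letters -/

namespace MealyAutomaton

variable {X S : Type*} (A : MealyAutomaton X S)

theorem stateAt_eq_of_eq_prefix (s : S) {ω ω' : ℕ → X} {n : ℕ} (h : ∀ i < n, ω i = ω' i) :
    A.stateAt s ω n = A.stateAt s ω' n := by
  induction n with
  | zero => rfl
  | succ n ih =>
    simp only [stateAt]
    rw [ih fun i hi => h i (hi.trans n.lt_succ_self), h n n.lt_succ_self]

/-- The state of the automaton together with the input letter that it reads at time `n`. -/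
def stateLetter (s : S) (ω : ℕ → X) (n : ℕ) : S × X := (A.stateAt s ω n, ω n)

variable {A} in
/-- An automaton that is `L`-strongly connected has a strongly connected skew product chain. -/
theorem IsStronglyConnectedFor.reflTransGen [DecidableEq S] {L : Matrix X X ℝ}
    (hA : A.IsStronglyConnectedFor L) (p q : S × X) :
    Relation.ReflTransGen (fun a b => A.skewMatrix L a b ≠ 0) p q := by
  have path (w : List X) (s : S) (x y : X) (hw : List.IsChain (fun a b => L a b ≠ 0)
      (x :: (w ++ [y]))) : Relation.ReflTransGen (fun a b => A.skewMatrix L a b ≠ 0)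
        (s, x) (A.run s (x :: w), y) := by
    induction w generalizing s x with
    | nil =>
      refine Relation.ReflTransGen.single ?_
      simpa [skewMatrix, run] using hw
    | cons z w ih =>
      rw [List.cons_append, List.isChain_cons_cons] at hw
      refine Relation.ReflTransGen.head (b := (A.next s x, z)) ?_ (ih (A.next s x) z hw.2)
      simpa [skewMatrix] using hw.1
  obtain ⟨w, hw, hchain⟩ := hA p.1 q.1 p.2 q.2
  simpa [hw] using path w p.1 p.2 q.2 hchain

variable [Fintype X] [Fintype S] [DecidableEq S] {L : Matrix X X ℝ}

/-- The next state is determined by the current pair; only the next letter is random. -/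
theorem skewMatrix_mulVec (h : S × X → ℝ) (p : S × X) :
    (A.skewMatrix L *ᵥ h) p = ∑ y, L p.2 y * h (A.next p.1 p.2, y) := by
  simp only [mulVec, dotProduct, skewMatrix, of_apply, Fintype.sum_prod_type, ite_mul, zero_mul]
  rw [Finset.sum_comm]
  simp

theorem skewMatrix_mem_rowStochastic [DecidableEq X] (hL : L ∈ rowStochastic ℝ X) :
    A.skewMatrix L ∈ rowStochastic ℝ (S × X) := by
  refine ⟨fun p q => ?_, ?_⟩
  · rw [skewMatrix, of_apply]
    split_ifs
    exacts [hL.1 _ _, le_rfl]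
  · ext p
    rw [skewMatrix_mulVec]
    simpa using sum_row_of_mem_rowStochastic hL p.2

/-- The ergodic theorem for the chain of pairs (state, input letter) of an automaton that reads
a random Markov sequence. -/
theorem ae_tendsto_avg_stateLetter [DecidableEq X] [MeasurableSpace X] [DiscreteMeasurableSpace X]
    (hL : L ∈ rowStochastic ℝ X) {l : X → ℝ} (hl : ∀ x, 0 ≤ l x)
    {μ : Measure (ℕ → X)} (hμ : IsMarkovMeasure μ L l) (hA : A.IsStronglyConnectedFor L)
    {t : S × X → ℝ} (ht : IsStationaryProbVec (A.skewMatrix L) t) (g : S) (f : S × X → ℝ) :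
    ∀ᵐ ω ∂μ, Tendsto
      (fun n : ℕ => (∑ i ∈ Finset.range n, f (A.stateLetter g ω i)) / n) atTop (𝓝 (t ⬝ᵥ f)) := by
  have := hμ.isProbabilityMeasure
  obtain ⟨h, hh⟩ := exists_poisson_solution (A.skewMatrix_mem_rowStochastic hL)
    hA.reflTransGen ht f
  set Th := A.skewMatrix L *ᵥ h with hTh
  -- The martingale difference: `h` at time `n + 1` minus its conditional expectation given the
  -- letters up to time `n`.
  let D (n : ℕ) (ω : ℕ → X) : ℝ := h (A.stateLetter g ω (n + 1)) - Th (A.stateLetter g ω n)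
  have hZ {ω ω' : ℕ → X} {n : ℕ} (hω : ∀ i ≤ n, ω i = ω' i) :
      A.stateLetter g ω n = A.stateLetter g ω' n := by
    rw [stateLetter, stateLetter, A.stateAt_eq_of_eq_prefix g fun i hi => hω i hi.le, hω n le_rfl]
  have hDeq {ω ω' : ℕ → X} {n : ℕ} (hω : ∀ i < n + 2, ω i = ω' i) : D n ω = D n ω' := by
    simp only [D]
    rw [hZ fun i hi => hω i (by lia), hZ fun i hi => hω i (by lia)]
  have hDm (n : ℕ) : Measurable (D n) := measurable_of_eq_of_eq_prefix (n + 2) fun _ _ => hDeq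
  obtain ⟨C, hC⟩ : ∃ C, ∀ p, |h p| ≤ C := by
    obtain ⟨C, hC⟩ := (Set.finite_range fun p => |h p|).bddAbove
    exact ⟨C, fun p => hC ⟨p, rfl⟩⟩
  obtain ⟨C', hC'⟩ : ∃ C, ∀ p, |Th p| ≤ C := by
    obtain ⟨C, hC⟩ := (Set.finite_range fun p => |Th p|).bddAbove
    exact ⟨C, fun p => hC ⟨p, rfl⟩⟩
  have hDb (n : ℕ) (ω : ℕ → X) : |D n ω| ≤ C + C' :=
    (abs_sub _ _).trans (add_le_add (hC _) (hC' _))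
  have horth (n : ℕ) : ∫ ω, (∑ i ∈ Finset.range n, D i ω) * D n ω ∂μ = 0 := by
    -- Letter `n + 1` becomes a free variable `y`; the rest depends only on letters `0, …, n`.
    let F (ω : ℕ → X) (y : X) : ℝ := (∑ i ∈ Finset.range n, D i ω) *
      (h (A.next (A.stateAt g ω n) (ω n), y) - Th (A.stateLetter g ω n))
    have hF : ∀ ω ω' : ℕ → X, (∀ i ≤ n, ω i = ω' i) → F ω = F ω' := by
      intro ω ω' hω
      ext y
      simp only [F]
      rw [hZ hω, A.stateAt_eq_of_eq_prefix g fun i hi => hω i hi.le, hω n le_rfl]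
      congr 1
      refine Finset.sum_congr rfl fun i hi => hDeq fun j hj => hω j ?_
      have := Finset.mem_range.1 hi
      lia
    have hmean (ω : ℕ → X) : ∑ y, L (ω n) y * F ω y = 0 := by
      simp only [F, mul_left_comm (L _ _), mul_sub]
      rw [Finset.sum_sub_distrib, ← Finset.mul_sum, ← Finset.mul_sum, ← Finset.sum_mul,
        sum_row_of_mem_rowStochastic hL, hTh, skewMatrix_mulVec, one_mul]
      exact sub_self _
    calc ∫ ω, (∑ i ∈ Finset.range n, D i ω) * D n ω ∂μ = ∫ ω, F ω (ω (n + 1)) ∂μ := rfl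
      _ = 0 := by
        rw [hμ.integral_next hl hL.1 n F hF]
        simp [hmean]
  filter_upwards [ae_tendsto_avg_zero hDm hDb horth] with ω hω
  -- Sum the Poisson equation along the path; the `h` terms telescope.
  have htel (n : ℕ) : ∑ i ∈ Finset.range n, f (A.stateLetter g ω i) =
      (h (A.stateLetter g ω 0) - h (A.stateLetter g ω n)) +
        ∑ i ∈ Finset.range n, D i ω + n * (t ⬝ᵥ f) := by
    induction n with
    | zero => simp
    | succ n ih =>
      rw [Finset.sum_range_succ, ih, Finset.sum_range_succ, hh (A.stateLetter g ω n)]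
      simp only [D]
      push_cast
      ring
  have hbd : Tendsto (fun n : ℕ => (h (A.stateLetter g ω 0) - h (A.stateLetter g ω n)) / n)
      atTop (𝓝 0) := by
    refine squeeze_zero_norm (fun n => ?_) (tendsto_const_div_atTop_nhds_zero_nat (C + C))
    rw [norm_div, RCLike.norm_natCast, Real.norm_eq_abs]
    gcongr
    exact (abs_sub _ _).trans (add_le_add (hC _) (hC _))
  have hlim := (hbd.add hω).add_const (t ⬝ᵥ f)
  rw [add_zero, zero_add] at hlim
  refine hlim.congr' ?_
  filter_upwards [eventually_gt_atTop 0] with n hn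
  have hn' : (n : ℝ) ≠ 0 := by exact_mod_cast hn.ne'
  rw [htel, add_div, add_div, mul_div_cancel_left₀ _ hn']

/-- An edge is determined by its source and input letter, so the sum over targets collapses. -/
theorem sum_edgesWithOutput [DecidableEq X] (t : S × X → ℝ) (x : X) :
    ∑ e ∈ A.edgesWithOutput x, t (e.1, e.2.1) =
      t ⬝ᵥ fun p => if A.out p.1 p.2 = x then 1 else 0 := by
  rw [edgesWithOutput, Finset.sum_filter, Fintype.sum_prod_type]
  simp_rw [dotProduct, Fintype.sum_prod_type, ite_and, mul_ite, mul_one, mul_zero]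
  simp

end MealyAutomaton

theorem seqShift_iterate {X : Type*} (ω : ℕ → X) (i j : ℕ) : (seqShift^[i] ω) j = ω (j + i) := by
  induction i generalizing ω with
  | zero => rfl
  | succ i ih =>
    rw [Function.iterate_succ_apply, ih, seqShift, add_assoc]

theorem theorem4p5 {X S : Type*} [Fintype X] [DecidableEq X] [MeasurableSpace X]
    [DiscreteMeasurableSpace X] [Fintype S] [DecidableEq S]
    (L : Matrix X X ℝ) (hL : L ∈ Matrix.rowStochastic ℝ X) (hirr : L.IsIrreducible)
    (l : X → ℝ) (hl : IsStationaryProbVec L l)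
    (μ : Measure (ℕ → X)) (hμ : IsMarkovMeasure μ L l)
    (A : MealyAutomaton X S) (hA : A.IsStronglyConnectedFor L) (g : S) :
    (∃! t : S × X → ℝ, IsStationaryProbVec (A.skewMatrix L) t) ∧
    ∀ t : S × X → ℝ, IsStationaryProbVec (A.skewMatrix L) t →
      ∀ x : X, ∀ᵐ ω ∂μ,
        Tendsto
          (fun n : ℕ => (1 / (n : ℝ)) * ∑ i ∈ Finset.range n,
            (seqCylinder ![x]).indicator (fun _ => (1 : ℝ)) (seqShift^[i] (A.action g ω)))
          atTop (𝓝 (∑ e ∈ A.edgesWithOutput x, t (e.1, e.2.1))) := by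
  have : Nonempty (S × X) := by
    rcases isEmpty_or_nonempty X with hX | ⟨⟨x⟩⟩
    -- Over an empty alphabet the entries of `l` could not sum to 1.
    · simpa using hl.1.2
    · exact ⟨(g, x)⟩
  refine ⟨existsUnique_isStationaryProbVec (A.skewMatrix_mem_rowStochastic hL) hA.reflTransGen,
    fun t ht x => ?_⟩
  filter_upwards [A.ae_tendsto_avg_stateLetter hL hl.1.1 hμ hA ht g
    fun p => if A.out p.1 p.2 = x then 1 else 0] with ω hω
  rw [A.sum_edgesWithOutput]
  refine hω.congr fun n => ?_
  rw [div_eq_inv_mul, one_div]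
  congr 1
  refine Finset.sum_congr rfl fun i _ => ?_
  classical
  rw [Set.indicator_apply]
  exact if_congr (by simp [seqCylinder, seqShift_iterate, MealyAutomaton.action,
    MealyAutomaton.stateLetter]) rfl rfl
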